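/- Let $k$ be a non-negative integer. In the $k$-visibility Localization game on a finite connected graph $G$ with $m$ cops, the robber first chooses a vertex of $G$. In each round the cops probe vertices $u_1,\dots,u_m$, chosen freely and depending only on the answers of the earlier rounds; if the robber is at $x$, the $i$-th answer is the distance $d(u_i,x)$ if this is at most $k$, and $\ast$ (no information) otherwise. Then the robber stays or moves to a neighbouring vertex, and the next round begins. The cops win if, after the probe of some round, exactly one vertex is a possible position of the robber given all answers so far. Let $\zeta_k(G)$ be the least positive integer $m$ such that $m$ cops have a strategy that wins in finitely many rounds against every behaviour of the robber. For every non-negative integer $k$ and every positive integer $d$, there is a finite tree $T$ with $\zeta_k(T) > d$. -/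

import Mathlib

namespace VisibilityLocalization

variable {V : Type*}

/-- A cop at `u` with visibility `k` probes while the robber is at `x`: the answer is the distance
from `u` to `x` if this is at most `k`, and `none` (no information) otherwise. -/
noncomputable def probe (G : SimpleGraph V) (k : ℕ) (u x : V) : Option ℕ :=
  if G.edist u x ≤ (k : ℕ∞) then some (G.dist u x) else none

/-- A strategy for `m` cops: the positions probed in a round, as a function of the distance vectors
returned in all the earlier rounds, listed in order. The cops may be placed anywhere. -/
abbrev Strategy (V : Type*) (m : ℕ) : Type _ :=
  List (Fin m → Option ℕ) → (Fin m → V)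

/-- `r n` is the position of the robber when the cops probe in round `n`, for `n = 0, 1, 2, ...`.
The robber starts anywhere, and between two probes stays or moves to a neighbour. -/
def IsRobberWalk (G : SimpleGraph V) (r : ℕ → V) : Prop :=
  ∀ n, r (n + 1) = r n ∨ G.Adj (r n) (r (n + 1))

/-- The distance vectors returned in the first `n` rounds, when the cops follow `σ` and the robber
follows `r`. -/
noncomputable def history (G : SimpleGraph V) (k : ℕ) {m : ℕ} (σ : Strategy V m) (r : ℕ → V) :
    ℕ → List (Fin m → Option ℕ)
  | 0 => []
  | n + 1 =>
      history G k σ r n ++ [fun i => probe G k (σ (history G k σ r n) i) (r n)]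

/-- The candidates right after the probe of round `n`: the vertices which the robber may occupy,
given all the distance vectors returned so far (that of round `n` included). -/
def candidates (G : SimpleGraph V) (k : ℕ) {m : ℕ} (σ : Strategy V m) (r : ℕ → V) (n : ℕ) :
    Set V :=
  {x | ∃ r' : ℕ → V, IsRobberWalk G r' ∧
    history G k σ r' (n + 1) = history G k σ r (n + 1) ∧ r' n = x}

/-- `σ` wins for the cops: whatever the robber does, there is a unique candidate after finitely
many rounds. -/
def IsWinning (G : SimpleGraph V) (k : ℕ) {m : ℕ} (σ : Strategy V m) : Prop :=
  ∀ r : ℕ → V, IsRobberWalk G r → ∃ n x, candidates G k σ r n = {x}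

/-- The `k`-visibility localization number: the least positive number of cops that have a winning
strategy in the `k`-visibility Localization game on `G`. -/
noncomputable def localizationNumber (G : SimpleGraph V) (k : ℕ) : ℕ :=
  sInf {m : ℕ | 0 < m ∧ ∃ σ : Strategy V m, IsWinning G k σ}

end VisibilityLocalization

open Finset
open scoped Pointwise

namespace VisibilityLocalization

/-! ### The game against a robber nobody has seen -/

section Game

variable {V : Type*} {G : SimpleGraph V} {k : ℕ}

/-! While every answer is `none`, the probes form a fixed sequence and all unseen robbers look
alike. Let the set of their positions spread to its neighbours and lose what the cops see, at most
`C = d * 4 ^ k` vertices per round in a tree of maximum degree 3. If every set with size in a window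
`[a, a + C)`, `a > 1`, has at least `C` outer neighbours, the set never drops below `a` and the cops
fail (`not_isWinning_of_expansion`). Deep binary trees have such a window. A set with a small outer
boundary cuts few edges, so its size is `0` or `2 ^ h` plus a signed sum of few subtree sizes `2 ^ i
- 1` (`card_mem_cutSizes`). These sums take only polynomially many values in `h`, so among `2 ^ h`
sizes some window avoids them all (`exists_expansion`). -/

theorem probe_eq_none {u x : V} (h : ¬ G.edist u x ≤ (k : ℕ∞)) : probe G k u x = none :=
  if_neg h

theorem probe_self (u : V) : probe G k u u = some 0 := by
  simp [probe]

theorem eq_of_probe_eq_some_zero {u x : V} (h : probe G k u x = some 0) : u = x := by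
  unfold probe at h
  split_ifs at h with hle
  have hd : G.dist u x = 0 := by simpa using h
  have hr : G.Reachable u x := by
    rw [← SimpleGraph.edist_ne_top_iff_reachable]
    exact ne_top_of_le_ne_top (ENat.natCast_ne_top k) hle
  exact hr.dist_eq_zero_iff.mp hd

/-- One cop on every vertex wins in the first round. -/
theorem exists_isWinning_card [Finite V] (G : SimpleGraph V) (k : ℕ) :
    ∃ σ : Strategy V (Nat.card V), IsWinning G k σ := by
  refine ⟨fun _ => (Finite.equivFin V).symm, fun r hr => ⟨0, r 0, ?_⟩⟩
  ext x
  constructor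
  · rintro ⟨r', -, hh, rfl⟩
    have h := congrFun (List.singleton_inj.mp hh) (Finite.equivFin V (r 0))
    simp only [Equiv.symm_apply_apply, probe_self] at h
    exact (eq_of_probe_eq_some_zero h).symm
  · rintro rfl
    exact ⟨r, hr, rfl, rfl⟩

/-- The strategy's probes in round `n` when no cop has ever seen the robber. -/
def blindProbe {m : ℕ} (σ : Strategy V m) (n : ℕ) : Fin m → V :=
  σ (List.replicate n fun _ => none)

/-- The robber is out of sight in round `n` at `x`, if he was in all the rounds before. -/
def Unseen (G : SimpleGraph V) (k : ℕ) {m : ℕ} (σ : Strategy V m) (n : ℕ) (x : V) : Prop :=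
  ∀ i, ¬ G.edist (blindProbe σ n i) x ≤ (k : ℕ∞)

theorem history_eq_replicate {m : ℕ} {σ : Strategy V m} {r : ℕ → V} {n : ℕ}
    (h : ∀ j < n, Unseen G k σ j (r j)) :
    history G k σ r n = List.replicate n fun _ => none := by
  induction n with
  | zero => rfl
  | succ n ih =>
    rw [history, ih fun j hj => h j (hj.trans n.lt_succ_self), List.replicate_succ']
    congr 2
    funext i
    exact probe_eq_none (h n n.lt_succ_self i)

/-- If unseen robbers may last arbitrarily long, then one lasts forever. -/
theorem exists_forever_unseen [Finite V] {m : ℕ} {σ : Strategy V m}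
    (h : ∀ n, ∃ r : ℕ → V, IsRobberWalk G r ∧ ∀ j ≤ n, Unseen G k σ j (r j)) :
    ∃ r : ℕ → V, IsRobberWalk G r ∧ ∀ j, Unseen G k σ j (r j) := by
  -- König's lemma, as Cantor's intersection theorem in the compact product of copies of the finite
  -- discrete space `V`.
  let _ : TopologicalSpace V := ⊥
  have : DiscreteTopology V := ⟨rfl⟩
  let K : ℕ → Set (ℕ → V) := fun n =>
    {r | IsRobberWalk G r} ∩ {r | ∀ j ≤ n, Unseen G k σ j (r j)}
  have hwalk : IsClosed {r : ℕ → V | IsRobberWalk G r} := by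
    simp only [IsRobberWalk, Set.ofPred_forall]
    refine isClosed_iInter fun n => ?_
    exact (isClosed_discrete {p : V × V | p.2 = p.1 ∨ G.Adj p.1 p.2}).preimage
      (f := fun r : ℕ → V => (r n, r (n + 1))) (by fun_prop)
  have hclosed : ∀ n, IsClosed (K n) := fun n => by
    refine hwalk.inter ?_
    simp only [Set.ofPred_forall]
    refine isClosed_iInter fun j => isClosed_iInter fun _ => ?_
    exact (isClosed_discrete {x : V | Unseen G k σ j x}).preimage
      (f := fun r : ℕ → V => r j) (by fun_prop)
  obtain ⟨r, hr⟩ := IsCompact.nonempty_iInter_of_sequence_nonempty_isCompact_isClosed K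
    (fun n r hr => ⟨hr.1, fun j hj => hr.2 j (hj.trans n.le_succ)⟩) h
    (hclosed 0).isCompact hclosed
  rw [Set.mem_iInter] at hr
  exact ⟨r, (hr 0).1, fun j => (hr j).2 j le_rfl⟩

variable [Fintype V]

open Classical in
/-- The vertices of `S` and their neighbours. -/
noncomputable def closedNeighborFinset (G : SimpleGraph V) (S : Finset V) : Finset V :=
  {y | ∃ x ∈ S, y = x ∨ G.Adj x y}

theorem mem_closedNeighborFinset {S : Finset V} {y : V} :
    y ∈ closedNeighborFinset G S ↔ ∃ x ∈ S, y = x ∨ G.Adj x y := by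
  simp [closedNeighborFinset]

theorem subset_closedNeighborFinset (S : Finset V) : S ⊆ closedNeighborFinset G S :=
  fun x hx => mem_closedNeighborFinset.mpr ⟨x, hx, Or.inl rfl⟩

open Classical in
/-- The possible positions in round `n` of a robber who has not been seen. -/
noncomputable def unseenFinset (G : SimpleGraph V) (k : ℕ) {m : ℕ} (σ : Strategy V m) :
    ℕ → Finset V
  | 0 => {x | Unseen G k σ 0 x}
  | n + 1 => {x ∈ closedNeighborFinset G (unseenFinset G k σ n) | Unseen G k σ (n + 1) x}

/-- Standing still after round `n` makes it easy to append the next move in the induction. -/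
theorem exists_walk_of_mem_unseenFinset {m : ℕ} {σ : Strategy V m} {n : ℕ} {x : V}
    (hx : x ∈ unseenFinset G k σ n) :
    ∃ r : ℕ → V, IsRobberWalk G r ∧ (∀ j ≤ n, Unseen G k σ j (r j)) ∧ ∀ j, n ≤ j → r j = x := by
  induction n generalizing x with
  | zero =>
    refine ⟨fun _ => x, fun _ => Or.inl rfl, fun j hj => ?_, fun _ _ => rfl⟩
    obtain rfl : j = 0 := by omega
    simpa [unseenFinset] using hx
  | succ n ih =>
    simp only [unseenFinset, mem_filter, mem_closedNeighborFinset] at hx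
    obtain ⟨⟨y, hy, hyx⟩, hxu⟩ := hx
    obtain ⟨r, hr, hru, hrn⟩ := ih hy
    refine ⟨fun j => if j ≤ n then r j else x, fun j => ?_, fun j hj => ?_, fun j hj => ?_⟩
    · rcases lt_trichotomy j n with h | rfl | h
      · simpa [h.le, Nat.succ_le_of_lt h] using hr j
      · simpa [hrn j le_rfl] using hyx
      · simp [h.not_ge, (h.trans j.lt_succ_self).not_ge]
    · by_cases h : j ≤ n
      · simpa [h] using hru j h
      · obtain rfl : j = n + 1 := by omega
        simpa using hxu
    · simp [show ¬ j ≤ n by omega]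

theorem unseenFinset_subset_candidates {m : ℕ} {σ : Strategy V m} {r : ℕ → V}
    (hr : ∀ j, Unseen G k σ j (r j)) (n : ℕ) :
    (unseenFinset G k σ n : Set V) ⊆ candidates G k σ r n := by
  intro x hx
  obtain ⟨r', hr', hu, hn⟩ := exists_walk_of_mem_unseenFinset hx
  refine ⟨r', hr', ?_, hn n le_rfl⟩
  rw [history_eq_replicate fun j _ => hr j,
    history_eq_replicate fun j hj => hu j (Nat.lt_succ_iff.mp hj)]

/-- If at all times an unseen robber has two possible positions, then the cops do not win. -/
theorem not_isWinning_of_one_lt_card {m : ℕ} {σ : Strategy V m}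
    (h : ∀ n, 1 < #(unseenFinset G k σ n)) : ¬ IsWinning G k σ := by
  intro hσ
  obtain ⟨r, hr, hu⟩ := exists_forever_unseen (G := G) (k := k) (σ := σ) fun n => by
    obtain ⟨x, hx⟩ := card_pos.mp (zero_lt_one.trans (h n))
    obtain ⟨r, hr, hu, -⟩ := exists_walk_of_mem_unseenFinset hx
    exact ⟨r, hr, hu⟩
  obtain ⟨n, x, hx⟩ := hσ r hr
  obtain ⟨y, hy, z, hz, hyz⟩ := one_lt_card.mp (h n)
  have hsub := unseenFinset_subset_candidates hu n
  rw [hx] at hsub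
  exact hyz ((hsub hy).trans (hsub hz).symm)

open Classical in
theorem card_le_card_filter_unseen_add {m B : ℕ} (σ : Strategy V m)
    (hB : ∀ u, #{x | G.edist u x ≤ (k : ℕ∞)} ≤ B) (n : ℕ) (S : Finset V) :
    #S ≤ #{x ∈ S | Unseen G k σ n x} + m * B := by
  have hsub : {x ∈ S | ¬ Unseen G k σ n x} ⊆
      (univ : Finset (Fin m)).biUnion fun i => {x | G.edist (blindProbe σ n i) x ≤ (k : ℕ∞)} := by
    intro x hx
    simpa [Unseen] using (mem_filter.mp hx).2
  have hle : #{x ∈ S | ¬ Unseen G k σ n x} ≤ m * B := by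
    refine (card_le_card hsub).trans ((card_biUnion_le_card_mul _ _ B fun i _ => hB _).trans ?_)
    simp
  rw [← card_filter_add_card_filter_not (s := S) fun x => Unseen G k σ n x]
  omega

open Classical in
/-- If all vertex sets of size in a window of length `C` have at least `C` outer neighbours, then
cops who see at most `C` vertices in a round do not win. -/
theorem not_isWinning_of_expansion {m a B C : ℕ} (σ : Strategy V m) (ha : 1 < a)
    (hB : ∀ u, (Set.ncard {x | G.edist u x ≤ (k : ℕ∞)}) ≤ B) (hC : m * B ≤ C)
    (hV : a + C ≤ Fintype.card V)
    (hexp : ∀ S : Finset V, a ≤ #S → #S < a + C → #S + C ≤ #(closedNeighborFinset G S)) :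
    ¬ IsWinning G k σ := by
  have hB' : ∀ u, #{x | G.edist u x ≤ (k : ℕ∞)} ≤ B := fun u => by
    refine le_trans (le_of_eq ?_) (hB u)
    rw [← Set.ncard_coe_finset]
    simp
  refine not_isWinning_of_one_lt_card fun n => ha.trans_le ?_
  induction n with
  | zero =>
    have h := card_le_card_filter_unseen_add σ hB' 0 univ
    rw [card_univ] at h
    rw [unseenFinset]
    omega
  | succ n ih =>
    have h := card_le_card_filter_unseen_add σ hB' (n + 1)
      (closedNeighborFinset G (unseenFinset G k σ n))
    -- A set of size at least `a + C` can afford to lose `C`; a smaller one first gains `C` from its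
    -- boundary.
    have h1 := card_le_card (subset_closedNeighborFinset (G := G) (unseenFinset G k σ n))
    have h2 := hexp (unseenFinset G k σ n) ih
    rw [unseenFinset]
    omega

/-- The size of balls in a graph of bounded degree. -/
theorem ncard_ball_le {Δ : ℕ} (hΔ : ∀ v : V, #(closedNeighborFinset G {v}) ≤ Δ) (k : ℕ) (u : V) :
    Set.ncard {x | G.edist u x ≤ (k : ℕ∞)} ≤ Δ ^ k := by
  classical
  suffices h : ∃ S : Finset V, {x | G.edist u x ≤ (k : ℕ∞)} ⊆ (S : Set V) ∧ #S ≤ Δ ^ k by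
    obtain ⟨S, hS, hc⟩ := h
    exact (Set.ncard_le_ncard hS).trans (by rwa [Set.ncard_coe_finset])
  induction k with
  | zero =>
    refine ⟨{u}, fun x hx => ?_, by simp⟩
    have h0 : x = u := by simpa using hx
    simp [h0]
  | succ k ih =>
    obtain ⟨S, hS, hc⟩ := ih
    refine ⟨S.biUnion fun v => closedNeighborFinset G {v}, fun x hx => ?_, ?_⟩
    · have hne : G.edist u x ≠ ⊤ := ne_top_of_le_ne_top (ENat.natCast_ne_top _) hx
      obtain ⟨p, hp⟩ := SimpleGraph.exists_walk_of_edist_ne_top hne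
      have hpl : p.length ≤ k + 1 := by
        rw [Set.mem_ofPred_eq, ← hp] at hx
        exact_mod_cast hx
      simp only [coe_biUnion, Set.mem_iUnion, mem_coe, mem_closedNeighborFinset, mem_singleton,
        exists_eq_left]
      rcases Nat.eq_zero_or_pos p.length with h0 | h0
      · obtain rfl := SimpleGraph.Walk.eq_of_length_eq_zero h0
        exact ⟨u, hS (by simp), Or.inl rfl⟩
      · refine ⟨p.penultimate, hS ?_, Or.inr (p.adj_penultimate ?_)⟩
        · refine (SimpleGraph.edist_le p.dropLast).trans ?_
          have : p.dropLast.length ≤ k := by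
            simp only [SimpleGraph.Walk.dropLast, SimpleGraph.Walk.take_length]
            omega
          exact_mod_cast this
        · exact SimpleGraph.Walk.not_nil_iff_lt_length.mpr h0
    · refine (card_biUnion_le_card_mul _ _ Δ fun v _ => hΔ v).trans ?_
      rw [pow_succ]
      exact Nat.mul_le_mul_right _ hc

end Game

/-! ### Set sizes and boundaries in the binary tree -/

section Isoperimetry

theorem sum_range_two_mul (n : ℕ) (f : ℕ → ℤ) :
    ∑ v ∈ range (2 * n), f (v / 2) = 2 * ∑ v ∈ range n, f v := by
  induction n with
  | zero => simp
  | succ n ih =>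
    rw [show 2 * (n + 1) = 2 * n + 1 + 1 by ring, sum_range_succ, sum_range_succ, ih,
      sum_range_succ, show (2 * n + 1) / 2 = n by omega, show 2 * n / 2 = n by omega]
    ring

/-- The sum of a function over a binary tree, in terms of its differences along the edges. -/
theorem sum_range_two_pow_eq (f : ℕ → ℤ) (h : ℕ) :
    ∑ v ∈ range (2 ^ h), f v =
      2 ^ h * f 0 + ∑ v ∈ range (2 ^ h), (f v - f (v / 2)) * (2 ^ (h - Nat.log 2 v) - 1) := by
  induction h with
  | zero => simp
  | succ h ih =>
    -- Write `f v` as `f (v / 2)` plus a difference; halving maps the deeper tree two-to-one onto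
    -- the shallower one. The root, its own parent, contributes difference 0.
    have h1 : ∑ v ∈ range (2 ^ (h + 1)), f v =
        2 * ∑ v ∈ range (2 ^ h), f v + ∑ v ∈ range (2 ^ (h + 1)), (f v - f (v / 2)) := by
      rw [sum_sub_distrib, pow_succ', sum_range_two_mul]
      ring
    have hle : 2 ^ h ≤ 2 ^ (h + 1) := Nat.pow_le_pow_right two_pos h.le_succ
    rw [h1, ih, ← sum_range_add_sum_Ico _ hle, ← sum_range_add_sum_Ico _ hle]
    have h2 : ∀ v ∈ range (2 ^ h), (f v - f (v / 2)) * (2 ^ (h + 1 - Nat.log 2 v) - 1) =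
        2 * ((f v - f (v / 2)) * (2 ^ (h - Nat.log 2 v) - 1)) + (f v - f (v / 2)) := by
      intro v hv
      have : Nat.log 2 v ≤ h := by
        refine (Nat.log_mono_right (mem_range.mp hv).le).trans ?_
        rw [Nat.log_pow one_lt_two]
      rw [Nat.succ_sub this, pow_succ]
      ring
    have h3 : ∀ v ∈ Ico (2 ^ h) (2 ^ (h + 1)),
        (f v - f (v / 2)) * (2 ^ (h + 1 - Nat.log 2 v) - 1) = f v - f (v / 2) := by
      intro v hv
      rw [mem_Ico] at hv
      rw [Nat.log_eq_of_pow_le_of_lt_pow hv.1 hv.2, Nat.add_sub_cancel_left]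
      ring
    rw [sum_congr rfl h2, sum_congr rfl h3, sum_add_distrib, ← mul_sum, pow_succ]
    ring

theorem sum_mem_card_nsmul {ι : Type*} (D : Finset ι) (F : Finset ℤ) (g : ι → ℤ)
    (hg : ∀ i ∈ D, g i ∈ F) : ∑ i ∈ D, g i ∈ #D • F := by
  classical
  induction D using Finset.induction_on with
  | empty => simp
  | insert i D hi ih =>
    rw [sum_insert hi, card_insert_of_notMem hi, succ_nsmul']
    exact add_mem_add (hg i (mem_insert_self i D)) (ih fun j hj => hg j (mem_insert_of_mem hj))

/-- The subtree sizes of a binary tree with `2 ^ h` vertices, with signs. -/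
def signedSizes (h : ℕ) : Finset ℤ :=
  (range (h + 1)).image (fun i => (2 ^ i - 1 : ℤ)) ∪
    (range (h + 1)).image (fun i => -(2 ^ i - 1 : ℤ))

theorem card_signedSizes_le (h : ℕ) : #(signedSizes h) ≤ 2 * (h + 1) := by
  refine (card_union_le _ _).trans ?_
  have h1 := card_image_le (s := range (h + 1)) (f := fun i => (2 ^ i - 1 : ℤ))
  have h2 := card_image_le (s := range (h + 1)) (f := fun i => -(2 ^ i - 1 : ℤ))
  rw [card_range] at h1 h2
  omega

theorem zero_mem_signedSizes (h : ℕ) : (0 : ℤ) ∈ signedSizes h :=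
  mem_union_left _ (mem_image.mpr ⟨0, by simp, by simp⟩)

/-- The sizes which sets with at most `c` cut edges may have. -/
def cutSizes (h c : ℕ) : Finset ℤ := {0, 2 ^ h} + c • signedSizes h

theorem card_cutSizes_le (h c : ℕ) : #(cutSizes h c) ≤ 2 * (2 * (h + 1)) ^ c := by
  refine card_add_le.trans (Nat.mul_le_mul card_le_two ?_)
  exact card_nsmul_le.trans (Nat.pow_le_pow_left (card_signedSizes_le h) c)

/-- The outer boundary of `S` in the tree on `0, ..., 2 ^ h - 1` where the parent of `v` is
`v / 2`. -/
def outerBoundary (h : ℕ) (S : Finset ℕ) : Finset ℕ :=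
  {v ∈ range (2 ^ h) | v ∉ S ∧ (v / 2 ∈ S ∨ 2 * v ∈ S ∨ 2 * v + 1 ∈ S)}

/-- Summing the indicator of `S` by its differences leaves one signed subtree size per cut edge. The
endpoint outside `S` of a cut edge is a boundary vertex, and each vertex lies on at most three
edges. -/
theorem card_mem_cutSizes {h c : ℕ} {S : Finset ℕ} (hS : S ⊆ range (2 ^ h))
    (hc : #(outerBoundary h S) ≤ c) : (#S : ℤ) ∈ cutSizes h (3 * c) := by
  let f : ℕ → ℤ := fun v => if v ∈ S then 1 else 0
  let D : Finset ℕ := {v ∈ range (2 ^ h) | f v ≠ f (v / 2)}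
  have hsum : (#S : ℤ) = ∑ v ∈ range (2 ^ h), f v := by
    simp only [f, sum_ite_mem, inter_eq_right.mpr hS, sum_const, nsmul_eq_mul, mul_one]
  have hD : #D ≤ 3 * c := by
    have hsub : D ⊆ (outerBoundary h S).biUnion fun v => {v, 2 * v, 2 * v + 1} := by
      intro v hv
      simp only [D, f, mem_filter, mem_range] at hv
      simp only [mem_biUnion, outerBoundary, mem_filter, mem_range, mem_insert, mem_singleton]
      by_cases h1 : v ∈ S <;> by_cases h2 : v / 2 ∈ S <;> simp [h1, h2] at hv
      · refine ⟨v / 2, ⟨by omega, h2, Or.inr ?_⟩, by omega⟩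
        rcases Nat.mod_two_eq_zero_or_one v with h3 | h3
        · exact Or.inl (by rwa [show 2 * (v / 2) = v by omega])
        · exact Or.inr (by rwa [show 2 * (v / 2) + 1 = v by omega])
      · exact ⟨v, ⟨hv, h1, Or.inl h2⟩, Or.inl rfl⟩
    refine (card_le_card hsub).trans
      ((card_biUnion_le_card_mul _ _ 3 fun v _ => card_le_three).trans ?_)
    omega
  rw [hsum, sum_range_two_pow_eq, cutSizes]
  refine add_mem_add ?_ ?_
  · by_cases h0 : 0 ∈ S <;> simp [f, h0]
  · have hDsum : ∑ v ∈ D, (f v - f (v / 2)) * (2 ^ (h - Nat.log 2 v) - 1) =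
        ∑ v ∈ range (2 ^ h), (f v - f (v / 2)) * (2 ^ (h - Nat.log 2 v) - 1) := by
      refine sum_filter_of_ne fun v _ hv h0 => hv ?_
      rw [h0]
      ring
    rw [← hDsum]
    -- Since 0 is an allowed summand, fewer than `3 * c` cuts can be padded.
    refine nsmul_subset_nsmul_right (zero_mem_signedSizes h) hD (sum_mem_card_nsmul D _ _ ?_)
    intro v hv
    have hne := (mem_filter.mp hv).2
    have hr : h - Nat.log 2 v ∈ range (h + 1) := mem_range.mpr (by omega)
    by_cases h1 : v ∈ S <;> by_cases h2 : v / 2 ∈ S <;> simp [f, h1, h2] at hne ⊢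
    · exact mem_union_left _ (mem_image_of_mem _ hr)
    · simp [signedSizes]

/-- A finite set of integers misses one of sufficiently many consecutive windows. -/
theorem exists_window {C : ℕ} (hC : 0 < C) (R : Finset ℤ) :
    ∃ i ≤ #R, ∀ x : ℕ, 2 + i * C ≤ x → x < 2 + i * C + C → (x : ℤ) ∉ R := by
  by_contra! hcon
  -- The windows are disjoint, and this map recovers the index of the window containing `z`. They
  -- start at 2 so that later `a > 1`.
  have hsub : range (#R + 1) ⊆ R.image fun z => (z.toNat - 2) / C := by
    intro i hi
    obtain ⟨x, h1, h2, hx⟩ := hcon i (Nat.lt_succ_iff.mp (mem_range.mp hi))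
    refine mem_image.mpr ⟨x, hx, ?_⟩
    rw [Int.toNat_natCast, Nat.div_eq_iff hC]
    omega
  have := (card_le_card hsub).trans card_image_le
  rw [card_range] at this
  omega

theorem exists_large_two_pow (A c B : ℕ) : ∃ h : ℕ, A * (2 * (h + 1)) ^ c + B ≤ 2 ^ h := by
  -- With `n = h + 1`, this bound absorbs the `2 ^ c` from `(2 * (h + 1)) ^ c` and the extra 2 in `2
  -- ^ (h + 1)`.
  have hpos : (0 : ℝ) < 1 / (2 * (A * 2 ^ c + B + 1)) := by positivity
  obtain ⟨n, hn, hn1⟩ := (((tendsto_pow_const_div_const_pow_of_one_lt c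
    (one_lt_two (α := ℝ))).eventually_lt_const hpos).and (Filter.eventually_ge_atTop 1)).exists
  obtain ⟨h, rfl⟩ := Nat.exists_eq_add_of_le' hn1
  refine ⟨h, ?_⟩
  rw [div_lt_div_iff₀ (by positivity) (by positivity), one_mul] at hn
  have h1 : (h + 1) ^ c * (2 * (A * 2 ^ c + B + 1)) < 2 ^ (h + 1) := by exact_mod_cast hn
  have h2 : B * 1 ≤ B * (h + 1) ^ c := Nat.mul_le_mul_left B (Nat.one_le_pow _ _ h.succ_pos)
  rw [mul_pow]
  rw [pow_succ 2 h] at h1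
  linarith [Nat.zero_le ((h + 1) ^ c)]

/-- Binary trees have vertex set sizes at which the boundary is large. -/
theorem exists_expansion {C : ℕ} (hC : 0 < C) :
    ∃ h a : ℕ, 1 < a ∧ a + C ≤ 2 ^ h ∧ ∀ S ⊆ range (2 ^ h), a ≤ #S → #S < a + C →
      C ≤ #(outerBoundary h S) := by
  obtain ⟨h, hh⟩ := exists_large_two_pow (2 * C) (3 * C) (2 + C)
  obtain ⟨i, hi, hw⟩ := exists_window hC (cutSizes h (3 * C))
  refine ⟨h, 2 + i * C, by omega, ?_, fun S hS h1 h2 => ?_⟩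
  · have := Nat.mul_le_mul_right C (hi.trans (card_cutSizes_le h (3 * C)))
    have h3 : 2 * (2 * (h + 1)) ^ (3 * C) * C = 2 * C * (2 * (h + 1)) ^ (3 * C) := by ring
    omega
  · by_contra! hlt
    exact hw _ h1 h2 (card_mem_cutSizes hS hlt.le)

end Isoperimetry

/-! ### The binary tree as a graph -/

section BinaryTree

/-- The binary tree on `0, ..., 2 ^ h - 1` where the parent of `v` is `v / 2`. -/
def binaryTree (h : ℕ) : SimpleGraph (Fin (2 ^ h)) :=
  SimpleGraph.fromRel fun u v => (v : ℕ) = u / 2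

theorem binaryTree_adj {h : ℕ} {u v : Fin (2 ^ h)} :
    (binaryTree h).Adj u v ↔ u ≠ v ∧ ((v : ℕ) = u / 2 ∨ (u : ℕ) = v / 2) :=
  SimpleGraph.fromRel_adj _ _ _

theorem binaryTree_isTree (h : ℕ) : (binaryTree h).IsTree := by
  classical
  have hpos : 0 < 2 ^ h := by positivity
  have hreach : ∀ n (hn : n < 2 ^ h), (binaryTree h).Reachable ⟨n, hn⟩ ⟨0, hpos⟩ := by
    intro n
    induction n using Nat.strong_induction_on with
    | _ n ih =>
      intro hn
      rcases Nat.eq_zero_or_pos n with rfl | h0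
      · exact SimpleGraph.Reachable.refl _
      · have hlt : n / 2 < n := by omega
        refine SimpleGraph.Reachable.trans (SimpleGraph.Adj.reachable ?_)
          (ih (n / 2) hlt (hlt.trans hn))
        exact binaryTree_adj.mpr ⟨by simp; omega, Or.inl rfl⟩
  have hconn : (binaryTree h).Connected :=
    { preconnected := fun u v => (hreach u u.2).trans (hreach v v.2).symm
      nonempty := ⟨⟨0, hpos⟩⟩ }
  rw [SimpleGraph.isTree_iff_connected_and_card]
  refine ⟨hconn, le_antisymm ?_ hconn.card_vert_le_card_edgeSet_add_one⟩
  -- Every edge joins a nonzero vertex to its parent, so there are at most `2 ^ h - 1` edges.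
  let p : Fin (2 ^ h) → Fin (2 ^ h) := fun v => ⟨v / 2, (Nat.div_le_self _ _).trans_lt v.2⟩
  have hsub : (binaryTree h).edgeSet ⊆
      (((univ : Finset (Fin (2 ^ h))).erase ⟨0, hpos⟩).image fun v => s(v, p v) :
        Finset (Sym2 (Fin (2 ^ h)))) := by
    have key : ∀ u v : Fin (2 ^ h), u ≠ v → (v : ℕ) = u / 2 → u ≠ ⟨0, hpos⟩ ∧ v = p u := by
      intro u v huv hv
      refine ⟨fun h0 => huv ?_, Fin.ext hv⟩
      rw [h0] at hv ⊢
      exact Fin.ext (by simpa using hv.symm)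
    intro e
    induction e with
    | _ u v =>
      intro he
      obtain ⟨huv, h1 | h1⟩ := binaryTree_adj.mp he
      · obtain ⟨h2, h3⟩ := key u v huv h1
        simp only [coe_image, Set.mem_image]
        exact ⟨u, by simpa using h2, by rw [h3]⟩
      · obtain ⟨h2, h3⟩ := key v u huv.symm h1
        simp only [coe_image, Set.mem_image]
        exact ⟨v, by simpa using h2, by rw [h3, Sym2.eq_swap]⟩
  have h1 : Nat.card (binaryTree h).edgeSet ≤ 2 ^ h - 1 := by
    rw [Nat.card_coe_set_eq]
    refine (Set.ncard_le_ncard hsub).trans ?_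
    rw [Set.ncard_coe_finset]
    refine card_image_le.trans ?_
    rw [card_erase_of_mem (mem_univ _), card_univ, Fintype.card_fin]
  rw [Nat.card_eq_fintype_card (α := Fin (2 ^ h)), Fintype.card_fin]
  omega

theorem card_closedNeighborFinset_binaryTree_le {h : ℕ} (v : Fin (2 ^ h)) :
    #(closedNeighborFinset (binaryTree h) {v}) ≤ 4 := by
  classical
  rw [← card_map Fin.valEmbedding]
  refine (card_le_card (t := {(v : ℕ), (v : ℕ) / 2, 2 * (v : ℕ), 2 * (v : ℕ) + 1}) ?_).trans
    card_le_four
  intro n hn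
  simp only [mem_map, mem_closedNeighborFinset, mem_singleton, exists_eq_left, binaryTree_adj] at hn
  obtain ⟨w, hw, rfl⟩ := hn
  simp only [Fin.valEmbedding_apply, mem_insert, mem_singleton]
  rcases hw with rfl | ⟨-, hw | hw⟩ <;> omega

theorem card_add_card_outerBoundary_le {h : ℕ} (S : Finset (Fin (2 ^ h))) :
    #S + #(outerBoundary h (S.map Fin.valEmbedding)) ≤
      #(closedNeighborFinset (binaryTree h) S) := by
  classical
  have hdisj : Disjoint (S.map Fin.valEmbedding) (outerBoundary h (S.map Fin.valEmbedding)) :=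
    disjoint_left.mpr fun v hv hb => (mem_filter.mp hb).2.1 hv
  rw [← card_map Fin.valEmbedding (s := S), ← card_union_of_disjoint hdisj,
    ← card_map Fin.valEmbedding (s := closedNeighborFinset _ _)]
  refine card_le_card (union_subset (map_subset_map.mpr (subset_closedNeighborFinset S)) ?_)
  intro v hv
  simp only [outerBoundary, mem_filter, mem_range] at hv
  obtain ⟨hvlt, hvS, hv⟩ := hv
  have key : ∀ w ∈ S.map Fin.valEmbedding, v = w / 2 ∨ w = v / 2 →
      v ∈ (closedNeighborFinset (binaryTree h) S).map Fin.valEmbedding := by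
    intro w hw hvw
    obtain ⟨x, hx, rfl⟩ := mem_map.mp hw
    refine mem_map.mpr ⟨⟨v, hvlt⟩, mem_closedNeighborFinset.mpr ⟨x, hx, Or.inr ?_⟩, rfl⟩
    refine binaryTree_adj.mpr ⟨?_, hvw⟩
    rintro rfl
    exact hvS hw
  rcases hv with hv | hv | hv
  · exact key _ hv (Or.inr rfl)
  · exact key _ hv (Or.inl (by omega))
  · exact key _ hv (Or.inl (by omega))

end BinaryTree

end VisibilityLocalization

open VisibilityLocalization in
theorem mainTheorem7 (k d : ℕ) (hd : 0 < d) :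
    ∃ (V : Type) (_ : Finite V) (T : SimpleGraph V),
      T.IsTree ∧ d < VisibilityLocalization.localizationNumber T k := by
  have hC : 0 < d * 4 ^ k := by positivity
  obtain ⟨h, a, ha, haC, hexp⟩ := exists_expansion hC
  refine ⟨Fin (2 ^ h), inferInstance, binaryTree h, binaryTree_isTree h, ?_⟩
  -- Nonemptiness rules out the default value `sInf ∅ = 0`.
  have hne : {m : ℕ | 0 < m ∧ ∃ σ : Strategy (Fin (2 ^ h)) m,
      IsWinning (binaryTree h) k σ}.Nonempty :=
    ⟨_, by simp, exists_isWinning_card (binaryTree h) k⟩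
  by_contra! hle
  obtain ⟨-, σ, hσ⟩ := Nat.sInf_mem hne
  refine not_isWinning_of_expansion σ ha
    (ncard_ball_le card_closedNeighborFinset_binaryTree_le k) (Nat.mul_le_mul_right _ hle)
    (by simpa using haC) (fun S h1 h2 => ?_) hσ
  refine le_trans (Nat.add_le_add_left ?_ _) (card_add_card_outerBoundary_le S)
  refine hexp _ (fun v hv => ?_) (by simpa using h1) (by simpa using h2)
  obtain ⟨x, -, rfl⟩ := mem_map.mp hv
  exact mem_range.mpr x.2
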